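/- **Setting.** Consider a mixed-integer linear program with $m$ blocks $x_\ell\in X_\ell=\{x\in\mathbb Z^{p_\ell}\times\mathbb R^{q_\ell}: S_\ell x\le s_\ell\}$, cost $\sum_\ell c_\ell^Tx_\ell$ and $y$ coupling constraints $\sum_\ell A_\ell x_\ell\le b$. Put $Z=\prod_\ell \mathrm{conv}(X_\ell)$, $A=[A_1,\dots,A_m]$, $c=(c_1,\dots,c_m)$, let $\rho\in\mathbb R^y$ have entries $\rho_\zeta=y\cdot\max_\ell\big(\max_{x\in X_\ell}(A_\ell x)_\zeta-\min_{x\in X_\ell}(A_\ell x)_\zeta\big)$, and let $g(z)=Az-b+\rho$, $r=\max_{z\in Z}\|z\|$. For $\alpha,\delta>0$ let $$L_\kappa(z,\lambda)=c^Tz+\tfrac\alpha2\|z\|^2+\lambda^Tg(z)-\tfrac\delta2\|\lambda\|^2 ,$$ and let $(\hat z_\kappa,\hat\lambda_\kappa)$ be its saddle point on $Z\times\mathbb R^y_{\ge0}$ (minimum in $z$, maximum in $\lambda$). **Assumptions.** (1) $Z$ is nonempty and compact. (2) There is a Slater point $\bar z\in Z$, i.e. $g(\bar z)<0$ componentwise.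 Let $R=\big(c^T\bar z+\frac\alpha2\|\bar z\|^2+\|c\|r\big)/\min_{1\le j\le y}(-g_j(\bar z))$ and $M=\{\lambda\ge0:\|\lambda\|_1\le R\}$. (3) (Delays bounded by the positive integer $B$.) Every primal agent $i$ updates at least once in $\{k,\dots,k+B-1\}$ for every $k$, and at each of its update times $k$ the block $j\ne i$ it has onboard was computed by agent $j$ at a time $\tau^i_j(k)$ with $k-B<\tau^i_j(k)\le k$. **Algorithm.** The constraints are distributed over dual agents; $\lambda_{[a]}$ is the part of $\lambda$ owned by dual agent $a$ and $M_a=\{\mu\ge0:\|\mu\|_1\le R\}$ is the corresponding set for its block. Each agent stores its own copy of $z$ and of $\lambda$; the primal copies start in $Z$, and $\lambda(0)\in M$. At each of its update times $k$, primal agent $i$ sets $z^i_{[i]}(k+1)=\Pi_{\mathrm{conv}(X_i)}\big[z^i_{[i]}(k)-\gamma\nabla_{z_{[i]}}L_\kappa(z^i(k),\lambda^i(k))\big]$; otherwise it keeps its block. When agent $i$ receives block $j$ it overwrites its copy by $z^j_{[j]}(\tau^i_j(k+1))$; otherwise it keeps the copy. For a set $D$ of positive integers, at the times $tB$ with $t\in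 D$ each dual agent $a$ has the current primal blocks it needs and sets $\lambda^a_{[a]}(tB)=\Pi_{M_a}\big[\lambda^a_{[a]}(tB-1)+\beta\nabla_{\lambda_{[a]}}L_\kappa(z^a(tB),\lambda^a(tB-1))\big]$; at all other times it keeps its block. All primal agents use the current values of the dual blocks that they need. Let $z(k)=(z^1_{[1]}(k),\dots,z^m_{[m]}(k))$, let $\lambda(k)$ be composed of the blocks $\lambda^a_{[a]}(k)$, let $t_1<t_2<\cdots$ be the elements of $D$, and let $t_0=0$. **Theorem.** Under these assumptions there are constants $\gamma_1>0$ and $\theta>0$, depending only on the problem data, $\alpha$, $\delta$ and $B$, such that for every primal step size $\gamma\in(0,\gamma_1)$ and every dual step size $\beta$ with $$0<\beta<\min\Big\{\frac{2\alpha}{\|A\|_2+2\alpha\delta},\ \frac{2\delta}{1+\delta^2}\Big\}$$ the numbers $q_p=1-\theta\gamma$ and $q_d=(1-\beta\delta)^2+\beta^2$ lie in $[0,1)$, and for every execution of the algorithm and every $n\ge1$ for which $t_n$ exists the following holds. The number $q_p$ is a contraction factor of the primal iteration between dual updates, $$\|z(t_nB)-\hat z\|\le q_p^{t_n-t_{n-1}}\|z(t_{n-1}B)-\hat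 z\|\quad\text{where}\quad \hat z=\arg\min_{z\in Z}L_\kappa(z,\lambda(t_{n-1}B)),$$ and $$\|z(t_nB)-\hat z_\kappa\|\le 2q_p^{t_n-t_{n-1}}r+\frac{\|A\|_2}{\alpha}\Big(q_d^{\,n-1}\|\lambda(0)-\hat\lambda_\kappa\|^2+\big(4r^2q_dq_p^2\|A\|_2^2+8r^2\beta^2q_p\|A\|_2^2\big)\sum_{i=0}^{n-1}q_d^{\,i}\Big)^{1/2}.$$ -/

import Mathlib

noncomputable section

/-- The data of a mixed-integer linear program over `m` blocks, with block `ℓ` in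
`ℤ ^ p ℓ × ℝ ^ q ℓ`, local constraints `S ℓ x ≤ s ℓ`, cost `∑ ℓ, ⟪c ℓ, x ℓ⟫` and `y` coupling
constraints `∑ ℓ, A ℓ x ℓ ≤ b`. -/
structure MILP where
  m : ℕ
  y : ℕ
  v : ℕ
  p : Fin m → ℕ
  q : Fin m → ℕ
  S : (l : Fin m) → Matrix (Fin v) (Fin (p l) ⊕ Fin (q l)) ℝ
  s : Fin m → Fin v → ℝ
  c : (l : Fin m) → EuclideanSpace ℝ (Fin (p l) ⊕ Fin (q l))
  A : (l : Fin m) → Matrix (Fin y) (Fin (p l) ⊕ Fin (q l)) ℝ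
  b : EuclideanSpace ℝ (Fin y)

/-- `w` is the Euclidean projection of `x` onto `C`. -/
def IsProjOnto {E : Type*} [NormedAddCommGroup E] (C : Set E) (x w : E) : Prop :=
  w ∈ C ∧ ∀ u ∈ C, ‖x - w‖ ≤ ‖x - u‖

namespace MILP

/-- The space of one primal block. -/
abbrev Block (P : MILP) (l : Fin P.m) : Type := EuclideanSpace ℝ (Fin (P.p l) ⊕ Fin (P.q l))

/-- The space of `z = (z_1, …, z_m)`, with the Euclidean norm of the concatenated vector. -/
abbrev Primal (P : MILP) : Type := PiLp 2 (fun l : Fin P.m => P.Block l)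

/-- The space of dual vectors. -/
abbrev Dual (P : MILP) : Type := EuclideanSpace ℝ (Fin P.y)

/-- The local mixed-integer feasible set of block `l`. -/
def X (P : MILP) (l : Fin P.m) : Set (P.Block l) :=
  {x | (∀ i : Fin (P.p l), ∃ k : ℤ, x (Sum.inl i) = k) ∧
    ∀ j : Fin P.v, (P.S l).mulVec (fun i => x i) j ≤ P.s l j}

/-- The convexified local set of block `l`. -/
def Zblock (P : MILP) (l : Fin P.m) : Set (P.Block l) := convexHull ℝ (P.X l)

/-- The product `Z = Z_1 × ⋯ × Z_m`. -/
def Z (P : MILP) : Set P.Primal := {z | ∀ l, z l ∈ P.Zblock l}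

/-- The concatenated cost vector. -/
def cost (P : MILP) : P.Primal := WithLp.toLp 2 P.c

/-- The concatenated matrix `[A_1, …, A_m]` as a linear operator between Euclidean spaces; its
operator norm is the spectral norm. -/
def Aop (P : MILP) : P.Primal →L[ℝ] P.Dual :=
  ∑ l, (LinearMap.toContinuousLinearMap (Matrix.toEuclideanLin (P.A l))).comp
    (PiLp.proj 2 (fun l : Fin P.m => P.Block l) l)

/-- The tightening vector: its entry `ζ` is `y` times the largest variation over the local
mixed-integer sets of the `ζ`-th row of the coupling constraints. -/
def rho (P : MILP) : P.Dual :=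
  WithLp.toLp 2 fun ζ => (P.y : ℝ) *
    ⨆ l : Fin P.m,
      (sSup ((fun x : P.Block l => (P.A l).mulVec (fun i => x i) ζ) '' P.X l) -
        sInf ((fun x : P.Block l => (P.A l).mulVec (fun i => x i) ζ) '' P.X l))

/-- The tightened coupling constraint function; the relaxed problem requires `g z ≤ 0`. -/
def g (P : MILP) (z : P.Primal) : P.Dual := P.Aop z - P.b + P.rho

/-- The radius `r = max_{z ∈ Z} ‖z‖`. -/
def r (P : MILP) : ℝ := sSup ((fun z : P.Primal => ‖z‖) '' P.Z)

/-- The regularized Lagrangian. -/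
def L (P : MILP) (α δ : ℝ) (z : P.Primal) (lam : P.Dual) : ℝ :=
  inner ℝ P.cost z + α / 2 * ‖z‖ ^ 2 + inner ℝ lam (P.g z) - δ / 2 * ‖lam‖ ^ 2

/-- The nonnegative orthant of the dual space. -/
def nonnegDual (P : MILP) : Set P.Dual := {lam | ∀ ζ, 0 ≤ lam ζ}

/-- `(zhat, lamhat)` is a saddle point of the regularized Lagrangian on `Z × ℝ₊^y`
(minimum in the first variable, maximum in the second). -/
def IsSaddle (P : MILP) (α δ : ℝ) (zhat : P.Primal) (lamhat : P.Dual) : Prop :=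
  zhat ∈ P.Z ∧ lamhat ∈ P.nonnegDual ∧
    IsSaddlePointOn P.Z P.nonnegDual (P.L α δ) zhat lamhat

/-- `zbar` is a Slater point. -/
def IsSlater (P : MILP) (zbar : P.Primal) : Prop := zbar ∈ P.Z ∧ ∀ ζ, P.g zbar ζ < 0

/-- The bound on the `ℓ¹` norm of the optimal multiplier given by the Slater point `zbar`. -/
def dualBound (P : MILP) (α : ℝ) (zbar : P.Primal) : ℝ :=
  (inner ℝ P.cost zbar + α / 2 * ‖zbar‖ ^ 2 + ‖P.cost‖ * P.r) / ⨅ ζ, -(P.g zbar ζ)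

/-- The compact set `M` of dual vectors. -/
def M (P : MILP) (α : ℝ) (zbar : P.Primal) : Set P.Dual :=
  {lam | (∀ ζ, 0 ≤ lam ζ) ∧ ∑ ζ, |lam ζ| ≤ P.dualBound α zbar}

/-- The block of a dual vector that belongs to dual agent `a`, when the constraints are
distributed over `N` dual agents by `owner`. -/
def dualBlock (P : MILP) {N : ℕ} (owner : Fin P.y → Fin N) (a : Fin N) (lam : P.Dual) :
    EuclideanSpace ℝ {ζ // owner ζ = a} :=
  WithLp.toLp 2 fun ζ => lam ζ.1

/-- The set `M_a` onto which dual agent `a` projects its block. -/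
def Mblock (P : MILP) {N : ℕ} (owner : Fin P.y → Fin N) (α : ℝ) (zbar : P.Primal) (a : Fin N) :
    Set (EuclideanSpace ℝ {ζ // owner ζ = a}) :=
  {mu | (∀ ζ, 0 ≤ mu ζ) ∧ ∑ ζ, |mu ζ| ≤ P.dualBound α zbar}

/-- Variables of primal block `i` appear in a constraint owned by dual agent `a`: only then do
the two agents have to communicate. -/
def Coupled (P : MILP) {N : ℕ} (owner : Fin P.y → Fin N) (a : Fin N) (i : Fin P.m) : Prop :=
  ∃ ζ, owner ζ = a ∧ ∃ j, P.A i ζ j ≠ 0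

/-- The timing of an execution. -/
structure Schedule (P : MILP) where
  /-- `K i`: the times at which primal agent `i` updates its block. -/
  K : Fin P.m → Set ℕ
  /-- `recv i j`: the times at which primal agent `i` receives a value of block `j`. -/
  recv : Fin P.m → Fin P.m → Set ℕ
  /-- `tau i j k`: the time at which agent `j` originally computed the value of block `j` that
  agent `i` has onboard at time `k`. -/
  tau : Fin P.m → Fin P.m → ℕ → ℕ
  /-- The dual updates take place at the times `t * B` with `t ∈ D`. -/
  D : Set ℕ

/-- The laws of a schedule: an onboard value was computed in the past, its time stamp changes
only when a new value is received, and no dual update takes place at the initial time. -/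
structure Schedule.IsValid {P : MILP} (σ : P.Schedule) : Prop where
  causal : ∀ i j, j ≠ i → ∀ k, σ.tau i j k ≤ k
  hold : ∀ i j, j ≠ i → ∀ k, k ∉ σ.recv i j → σ.tau i j (k + 1) = σ.tau i j k
  dual_pos : 0 ∉ σ.D

/-- Bounded delays (partial asynchrony) with delay bound `B`. -/
structure Schedule.BoundedDelays {P : MILP} (σ : P.Schedule) (B : ℕ) : Prop where
  update : ∀ i k, ∃ k' ∈ σ.K i, k ≤ k' ∧ k' ≤ k + B - 1
  delay : ∀ i j, j ≠ i → ∀ k ∈ σ.K i, k < σ.tau i j k + B ∧ σ.tau i j k ≤ k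

/-- The values stored onboard the agents at all times: every primal and every dual agent stores a
copy of the whole primal vector and of the whole dual vector. -/
structure Memory (P : MILP) (N : ℕ) where
  /-- `zP i k`: primal vector onboard primal agent `i` at time `k`. -/
  zP : Fin P.m → ℕ → P.Primal
  /-- `lamP i k`: dual vector onboard primal agent `i` at time `k`. -/
  lamP : Fin P.m → ℕ → P.Dual
  /-- `zD a k`: primal vector onboard dual agent `a` at time `k`. -/
  zD : Fin N → ℕ → P.Primal
  /-- `lamD a k`: dual vector onboard dual agent `a` at time `k`. -/
  lamD : Fin N → ℕ → P.Dual

/-- The true primal iterate `z(k) = (z^1_1(k), …, z^m_m(k))`. -/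
def Memory.z {P : MILP} {N : ℕ} (μ : P.Memory N) (k : ℕ) : P.Primal :=
  WithLp.toLp 2 fun i => μ.zP i k i

/-- The true dual iterate: each block is taken from the dual agent that owns it. -/
def Memory.lam {P : MILP} {N : ℕ} (μ : P.Memory N) (owner : Fin P.y → Fin N) (k : ℕ) : P.Dual :=
  WithLp.toLp 2 fun ζ => μ.lamD (owner ζ) k ζ

/-- `μ` is produced by the asynchronous block-based primal-dual algorithm with timing `σ`, primal
step size `γ`, dual step size `β`, dual updates at the times `t * B` with `t ∈ D`, and dual
projection sets given by the Slater point `zbar`. -/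
structure Memory.IsRun {P : MILP} {N : ℕ} (μ : P.Memory N) (owner : Fin P.y → Fin N)
    (α δ β γ : ℝ) (B : ℕ) (zbar : P.Primal) (σ : P.Schedule) : Prop where
  init_primal : ∀ i, μ.zP i 0 ∈ P.Z
  init_dual : μ.lam owner 0 ∈ P.M α zbar
  /-- Projected gradient step of agent `i` on its own block, with the values it has onboard. -/
  primal_update : ∀ i, ∀ k ∈ σ.K i,
    IsProjOnto (P.Zblock i)
      (μ.zP i k i - γ • (gradient (fun w => P.L α δ w (μ.lamP i k)) (μ.zP i k)) i)
      (μ.zP i (k + 1) i)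
  primal_hold : ∀ i k, k ∉ σ.K i → μ.zP i (k + 1) i = μ.zP i k i
  receive : ∀ i j, j ≠ i → ∀ k ∈ σ.recv i j,
    μ.zP i (k + 1) j = μ.zP j (σ.tau i j (k + 1)) j
  receive_hold : ∀ i j, j ≠ i → ∀ k, k ∉ σ.recv i j → μ.zP i (k + 1) j = μ.zP i k j
  /-- At the times of the dual updates the dual agents have the most recent primal blocks that
  they need. -/
  primal_to_dual : ∀ t ∈ σ.D, ∀ a i, P.Coupled owner a i → μ.zD a (t * B) i = μ.zP i (t * B) i
  /-- Projected gradient ascent step of dual agent `a` on its own block. -/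
  dual_update : ∀ t ∈ σ.D, ∀ a,
    IsProjOnto (P.Mblock owner α zbar a)
      (P.dualBlock owner a (μ.lamD a (t * B - 1)) +
        β • P.dualBlock owner a
          (gradient (fun w => P.L α δ (μ.zD a (t * B)) w) (μ.lamD a (t * B - 1))))
      (P.dualBlock owner a (μ.lamD a (t * B)))
  dual_hold : ∀ a k, (∀ t ∈ σ.D, k + 1 ≠ t * B) →
    P.dualBlock owner a (μ.lamD a (k + 1)) = P.dualBlock owner a (μ.lamD a k)
  /-- All primal agents use the same, current values of the dual blocks that they need. -/
  dual_to_primal : ∀ i a, P.Coupled owner a i → ∀ k,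
    P.dualBlock owner a (μ.lamP i k) = P.dualBlock owner a (μ.lamD a k)

end MILP

end

noncomputable section

section Generic

variable {E : Type*} [NormedAddCommGroup E] [InnerProductSpace ℝ E]

/-- The obtuse-angle characterization of the projection onto a convex set. -/
lemma IsProjOnto.inner_nonpos {C : Set E} (hC : Convex ℝ C) {x w : E} (h : IsProjOnto C x w)
    {u : E} (hu : u ∈ C) : inner ℝ (x - w) (u - w) ≤ 0 := by
  have hinf : ‖x - w‖ = ⨅ v : C, ‖x - v‖ := by
    have : Nonempty C := ⟨⟨w, h.1⟩⟩
    apply le_antisymm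
    · exact le_ciInf fun v => h.2 v v.2
    · exact ciInf_le ⟨0, by rintro _ ⟨v, rfl⟩; exact norm_nonneg _⟩ (⟨w, h.1⟩ : C)
  exact (norm_eq_iInf_iff_real_inner_le_zero hC h.1).1 hinf u hu

/-- Two points that satisfy the obtuse-angle inequality against each other are at most as far
apart as the points they are projected from. -/
lemma norm_sub_le_of_inner_nonpos {a b w v : E} (hw : inner ℝ (a - w) (v - w) ≤ 0)
    (hv : inner ℝ (b - v) (w - v) ≤ 0) : ‖w - v‖ ≤ ‖a - b‖ := by
  have h1 : ‖w - v‖ ^ 2 ≤ inner ℝ (a - b) (w - v) := by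
    have h2 : inner ℝ (a - b) (w - v) =
        ‖w - v‖ ^ 2 - inner ℝ (a - w) (v - w) - inner ℝ (b - v) (w - v) := by
      rw [← real_inner_self_eq_norm_sq, ← neg_sub w v, inner_neg_right, sub_neg_eq_add,
        ← inner_add_left, ← inner_sub_left]
      congr 1
      abel
    linarith
  have h3 := real_inner_le_norm (a - b) (w - v)
  rcases (norm_nonneg (w - v)).eq_or_lt with h | h
  · rw [← h]; exact norm_nonneg _
  · exact le_of_mul_le_mul_right (by nlinarith) h

/-- First-order optimality of a minimizer of a quadratic function over a convex set. -/
lemma inner_nonneg_of_isMinOn {C : Set E} (hC : Convex ℝ C) {f : E → ℝ} {w G : E} {a : ℝ}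
    (ha : 0 ≤ a) (hf : ∀ z, f z = f w + inner ℝ G (z - w) + a / 2 * ‖z - w‖ ^ 2)
    (hw : w ∈ C) (hmin : IsMinOn f C w) {z : E} (hz : z ∈ C) : 0 ≤ inner ℝ G (z - w) := by
  by_contra! hlt
  set p := inner ℝ G (z - w)
  set s := a / 2 * ‖z - w‖ ^ 2
  have hs : 0 ≤ s := by positivity
  have hsp : 0 < s - p := by linarith
  set t := -p / (s - p)
  have ht0 : 0 < t := div_pos (by linarith) hsp
  have ht1 : t ≤ 1 := (div_le_one hsp).2 (by linarith)
  have ht : t * (s - p) = -p := div_mul_cancel₀ _ hsp.ne'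
  have hmem : w + t • (z - w) ∈ C := hC.add_smul_sub_mem hw hz ⟨ht0.le, ht1⟩
  have h1 : f w ≤ f (w + t • (z - w)) := hmin hmem
  rw [hf (w + t • (z - w)), add_sub_cancel_left, inner_smul_right, norm_smul, mul_pow,
    Real.norm_of_nonneg ht0.le] at h1
  have h2 : 0 ≤ t * (p + t * s) := by
    have : t * (p + t * s) = t * p + a / 2 * (t ^ 2 * ‖z - w‖ ^ 2) := by
      simp only [s]; ring
    rw [this]; linarith
  nlinarith [nonneg_of_mul_nonneg_right h2 ht0, mul_pos ht0 (neg_pos.2 hlt)]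

/-- A quadratic function has the expected gradient. -/
lemma hasGradientAt_of_quadratic [CompleteSpace E] {f : E → ℝ} {w G : E} {a : ℝ}
    (hf : ∀ z, f z = f w + inner ℝ G (z - w) + a / 2 * ‖z - w‖ ^ 2) : HasGradientAt f G w := by
  rw [hasGradientAt_iff_isLittleO]
  have h1 : (fun z => f z - f w - inner ℝ G (z - w)) = fun z => a / 2 * ‖z - w‖ ^ 2 := by
    funext z
    rw [hf z]; ring
  rw [h1]
  refine Asymptotics.IsLittleO.const_mul_left ?_ _
  have h2 : (fun x : E => ‖x‖ ^ 2) =o[nhds 0] fun x : E => x :=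
    (Asymptotics.isLittleO_norm_pow_id one_lt_two)
  have h3 : Filter.Tendsto (fun z : E => z - w) (nhds w) (nhds 0) := by
    have : Filter.Tendsto (fun z : E => z - w) (nhds w) (nhds (w - w)) :=
      (continuous_id.sub continuous_const).tendsto w
    rwa [sub_self] at this
  exact h2.comp_tendsto h3

end Generic

namespace MILP

variable {P : MILP}

lemma convex_Z (P : MILP) : Convex ℝ P.Z := by
  intro x hx y hy a b ha hb hab l
  exact (convex_convexHull ℝ (P.X l)) (hx l) (hy l) ha hb hab

lemma norm_le_r (hZ : IsCompact P.Z) {z : P.Primal} (hz : z ∈ P.Z) : ‖z‖ ≤ P.r :=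
  le_csSup (hZ.image continuous_norm).bddAbove ⟨z, hz, rfl⟩

lemma norm_sub_le_two_mul_r (hZ : IsCompact P.Z) {z w : P.Primal} (hz : z ∈ P.Z) (hw : w ∈ P.Z) :
    ‖z - w‖ ≤ 2 * P.r := by
  linarith [norm_sub_le z w, norm_le_r hZ hz, norm_le_r hZ hw]

lemma r_nonneg (P : MILP) : 0 ≤ P.r :=
  Real.sSup_nonneg (by rintro _ ⟨z, _, rfl⟩; exact norm_nonneg z)

/-- The gradient of the regularized Lagrangian in the primal variable. -/
def primalGrad (P : MILP) (α : ℝ) (z : P.Primal) (lam : P.Dual) : P.Primal :=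
  P.cost + α • z + ContinuousLinearMap.adjoint P.Aop lam

/-- The gradient of the regularized Lagrangian in the dual variable. -/
def dualGrad (P : MILP) (δ : ℝ) (z : P.Primal) (lam : P.Dual) : P.Dual :=
  P.g z - δ • lam

lemma g_sub (P : MILP) (z w : P.Primal) : P.g z - P.g w = P.Aop (z - w) := by
  simp only [g, map_sub]; abel

lemma L_primal_expand (α δ : ℝ) (lam : P.Dual) (w z : P.Primal) :
    P.L α δ z lam = P.L α δ w lam + inner ℝ (P.primalGrad α w lam) (z - w) +
      α / 2 * ‖z - w‖ ^ 2 := by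
  have h1 : inner ℝ lam (P.g z) = inner ℝ lam (P.g w) + inner ℝ lam (P.Aop (z - w)) := by
    rw [← g_sub, inner_sub_right]; ring
  have h2 : ‖z‖ ^ 2 = ‖w‖ ^ 2 + 2 * inner ℝ w (z - w) + ‖z - w‖ ^ 2 := by
    rw [← norm_add_sq_real, add_sub_cancel]
  simp only [L, primalGrad, h1, h2, inner_add_left, inner_smul_left,
    ContinuousLinearMap.adjoint_inner_left, inner_sub_right P.cost, RCLike.conj_to_real]
  ring

lemma L_dual_expand (α δ : ℝ) (z : P.Primal) (lam nu : P.Dual) :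
    P.L α δ z nu = P.L α δ z lam + inner ℝ (P.dualGrad δ z lam) (nu - lam) +
      (-δ) / 2 * ‖nu - lam‖ ^ 2 := by
  have h2 : ‖nu‖ ^ 2 = ‖lam‖ ^ 2 + 2 * inner ℝ lam (nu - lam) + ‖nu - lam‖ ^ 2 := by
    rw [← norm_add_sq_real, add_sub_cancel]
  simp only [L, dualGrad, h2, inner_sub_left, inner_smul_left, inner_sub_right (P.g z),
    RCLike.conj_to_real, real_inner_comm (P.g z)]
  ring

lemma gradient_L_primal (α δ : ℝ) (z : P.Primal) (lam : P.Dual) :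
    gradient (fun w => P.L α δ w lam) z = P.primalGrad α z lam :=
  (hasGradientAt_of_quadratic (L_primal_expand α δ lam z)).gradient

lemma gradient_L_dual (α δ : ℝ) (z : P.Primal) (lam : P.Dual) :
    gradient (fun w => P.L α δ z w) lam = P.dualGrad δ z lam :=
  (hasGradientAt_of_quadratic (L_dual_expand α δ z lam)).gradient

lemma Aop_apply (P : MILP) (z : P.Primal) (ζ : Fin P.y) :
    P.Aop z ζ = ∑ l, ∑ j, P.A l ζ j * z l j := by
  simp [Aop, Matrix.mulVec, dotProduct]

/-- A block of `Aᵀ lam` depends only on the entries of `lam` that belong to constraints in which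
the block appears. -/
lemma adjoint_apply_congr {lam nu : P.Dual} {i : Fin P.m}
    (h : ∀ ζ, (∃ j, P.A i ζ j ≠ 0) → lam ζ = nu ζ) :
    ContinuousLinearMap.adjoint P.Aop lam i = ContinuousLinearMap.adjoint P.Aop nu i := by
  refine ext_inner_right ℝ fun x => ?_
  have key : ∀ k : P.Dual, inner ℝ (ContinuousLinearMap.adjoint P.Aop k i) x =
      ∑ ζ, k ζ * ∑ j, P.A i ζ j * x j := by
    intro k
    have h1 : inner ℝ (ContinuousLinearMap.adjoint P.Aop k) (PiLp.single 2 i x) =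
        inner ℝ (ContinuousLinearMap.adjoint P.Aop k i) x := by
      rw [PiLp.inner_apply, Finset.sum_eq_single i]
      · simp
      · intro b _ hb
        simp [hb]
      · simp
    rw [← h1, ContinuousLinearMap.adjoint_inner_left, PiLp.inner_apply]
    refine Finset.sum_congr rfl fun ζ _ => ?_
    rw [Aop_apply, Finset.sum_eq_single i]
    · simp [mul_comm]
    · intro b _ hb
      simp [hb]
    · simp
  rw [key, key]
  refine Finset.sum_congr rfl fun ζ _ => ?_
  by_cases hζ : ∃ j, P.A i ζ j ≠ 0
  · rw [h ζ hζ]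
  · push Not at hζ
    simp [hζ]

lemma g_apply_congr {z w : P.Primal} {ζ : Fin P.y}
    (h : ∀ i, (∃ j, P.A i ζ j ≠ 0) → z i = w i) : P.g z ζ = P.g w ζ := by
  have : P.Aop z ζ = P.Aop w ζ := by
    rw [Aop_apply, Aop_apply]
    refine Finset.sum_congr rfl fun i _ => ?_
    by_cases hi : ∃ j, P.A i ζ j ≠ 0
    · rw [h i hi]
    · push Not at hi
      simp [hi]
  simp [g, this]

/-- The variational inequality of a minimizer of the Lagrangian over `Z`. -/
lemma primalGrad_inner_nonneg {α δ : ℝ} (hα : 0 < α) {lam : P.Dual} {w : P.Primal} (hw : w ∈ P.Z)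
    (hmin : IsMinOn (fun z => P.L α δ z lam) P.Z w) {z : P.Primal} (hz : z ∈ P.Z) :
    0 ≤ inner ℝ (P.primalGrad α w lam) (z - w) :=
  inner_nonneg_of_isMinOn P.convex_Z hα.le (L_primal_expand α δ lam w) hw hmin hz

/-- The blockwise variational inequality of a minimizer of the Lagrangian over `Z`. -/
lemma primalGrad_block_inner_nonneg {α δ : ℝ} (hα : 0 < α) {lam : P.Dual} {w : P.Primal}
    (hw : w ∈ P.Z) (hmin : IsMinOn (fun z => P.L α δ z lam) P.Z w) {i : Fin P.m} {x : P.Block i}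
    (hx : x ∈ P.Zblock i) : 0 ≤ inner ℝ (P.primalGrad α w lam i) (x - w i) := by
  have hmem : w + PiLp.single 2 i (x - w i) ∈ P.Z := by
    intro l
    by_cases hl : l = i
    · subst hl
      simpa using hx
    · simpa [PiLp.single_apply, hl] using hw l
  have h1 := primalGrad_inner_nonneg hα hw hmin hmem
  rw [add_sub_cancel_left, PiLp.inner_apply, Finset.sum_eq_single i] at h1
  · simpa using h1
  · intro b _ hb
    simp [hb]
  · simp

/-- Monotonicity of the dual function's gradient, with modulus given by the strong convexity of
the Lagrangian in the primal variable. -/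
lemma inner_Aop_sub_le {α δ : ℝ} (hα : 0 < α) {lam nu : P.Dual} {z w : P.Primal}
    (hz : z ∈ P.Z) (hzmin : IsMinOn (fun z => P.L α δ z lam) P.Z z)
    (hw : w ∈ P.Z) (hwmin : IsMinOn (fun z => P.L α δ z nu) P.Z w) :
    inner ℝ (lam - nu) (P.Aop (z - w)) ≤ -(α * ‖z - w‖ ^ 2) := by
  have h1 := primalGrad_inner_nonneg hα hz hzmin hw
  have h2 := primalGrad_inner_nonneg hα hw hwmin hz
  have h3 : inner ℝ (lam - nu) (P.Aop (z - w)) = -inner ℝ (P.primalGrad α z lam) (w - z) -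
      inner ℝ (P.primalGrad α w nu) (z - w) - α * ‖z - w‖ ^ 2 := by
    rw [← neg_sub z w, inner_neg_right, neg_neg, ← real_inner_self_eq_norm_sq,
      ← ContinuousLinearMap.adjoint_inner_left, map_sub]
    rw [← inner_sub_left, ← real_inner_smul_left, ← inner_sub_left]
    congr 1
    simp only [primalGrad, smul_sub]
    abel
  linarith

/-- The minimizer of the Lagrangian is a Lipschitz function of the multiplier. -/
lemma norm_argmin_sub_le {α δ : ℝ} (hα : 0 < α) {lam nu : P.Dual} {z w : P.Primal}
    (hz : z ∈ P.Z) (hzmin : IsMinOn (fun z => P.L α δ z lam) P.Z z)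
    (hw : w ∈ P.Z) (hwmin : IsMinOn (fun z => P.L α δ z nu) P.Z w) :
    ‖z - w‖ ≤ ‖P.Aop‖ / α * ‖lam - nu‖ := by
  have h1 := inner_Aop_sub_le hα hz hzmin hw hwmin
  have h2 := (abs_le.1 (abs_real_inner_le_norm (lam - nu) (P.Aop (z - w)))).1
  have h3 := mul_le_mul_of_nonneg_left (P.Aop.le_opNorm (z - w)) (norm_nonneg (lam - nu))
  rw [div_mul_eq_mul_div, le_div_iff₀ hα]
  rcases (norm_nonneg (z - w)).eq_or_lt with h | h
  · rw [← h, zero_mul]; positivity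
  · exact le_of_mul_le_mul_right (by nlinarith) h

lemma exists_argmin (hZne : P.Z.Nonempty) (hZ : IsCompact P.Z) (α δ : ℝ) (lam : P.Dual) :
    ∃ w ∈ P.Z, IsMinOn (fun z => P.L α δ z lam) P.Z w := by
  refine hZ.exists_isMinOn hZne (Continuous.continuousOn ?_)
  unfold L g
  fun_prop

namespace IsSaddle

variable {α δ : ℝ} {zhat : P.Primal} {lamhat : P.Dual}

lemma isMinOn (h : P.IsSaddle α δ zhat lamhat) :
    IsMinOn (fun z => P.L α δ z lamhat) P.Z zhat :=
  fun z hz => h.2.2 z hz lamhat h.2.1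

lemma dualGrad_inner_nonpos (h : P.IsSaddle α δ zhat lamhat) (hδ : 0 < δ) {nu : P.Dual}
    (hnu : nu ∈ P.nonnegDual) : inner ℝ (P.dualGrad δ zhat lamhat) (nu - lamhat) ≤ 0 := by
  have hconv : Convex ℝ P.nonnegDual := by
    intro x hx y hy a b ha hb _ ζ
    exact add_nonneg (mul_nonneg ha (hx ζ)) (mul_nonneg hb (hy ζ))
  have h1 := inner_nonneg_of_isMinOn (f := fun nu => -P.L α δ zhat nu) (a := δ)
    (G := -P.dualGrad δ zhat lamhat) hconv hδ.le
    (fun nu => by rw [L_dual_expand α δ zhat lamhat nu, inner_neg_left]; ring)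
    h.2.1 (fun nu hnu => neg_le_neg (h.2.2 zhat h.1 nu hnu)) hnu
  rw [inner_neg_left] at h1
  linarith

/-- A Slater point bounds the `ℓ¹` norm of the optimal multiplier. -/
lemma sum_abs_le_dualBound (h : P.IsSaddle α δ zhat lamhat) (hZ : IsCompact P.Z) (hα : 0 < α)
    (hδ : 0 < δ) {zbar : P.Primal} (hs : P.IsSlater zbar) :
    ∑ ζ, |lamhat ζ| ≤ P.dualBound α zbar := by
  rcases isEmpty_or_nonempty (Fin P.y) with hy | hy
  · simp [dualBound]
  have habs : ∀ ζ, |lamhat ζ| = lamhat ζ := fun ζ => abs_of_nonneg (h.2.1 ζ)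
  have hpos : 0 < ⨅ ζ, -(P.g zbar ζ) := by
    obtain ⟨ζ, hζ⟩ := exists_eq_ciInf_of_finite (f := fun ζ => -(P.g zbar ζ))
    rw [← hζ]
    exact neg_pos.2 (hs.2 ζ)
  simp only [habs]
  rw [dualBound, le_div_iff₀ hpos, Finset.sum_mul]
  have h1 : ∑ ζ, lamhat ζ * ⨅ ζ, -(P.g zbar ζ) ≤ -inner ℝ lamhat (P.g zbar) := by
    rw [PiLp.inner_apply, ← Finset.sum_neg_distrib]
    refine Finset.sum_le_sum fun ζ _ => ?_
    have := mul_le_mul_of_nonneg_left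
      (ciInf_le (Set.finite_range fun ζ => -(P.g zbar ζ)).bddBelow ζ) (h.2.1 ζ)
    simpa [mul_comm] using this
  have h2 : P.L α δ zhat 0 ≤ P.L α δ zbar lamhat := h.2.2 zbar hs.1 0 (fun ζ => le_rfl)
  have h3 := (abs_le.1 (abs_real_inner_le_norm P.cost zhat)).1
  have h4 := mul_le_mul_of_nonneg_left (norm_le_r hZ h.1) (norm_nonneg P.cost)
  simp only [L, inner_zero_left, norm_zero] at h2
  have h5 : 0 ≤ α / 2 * ‖zhat‖ ^ 2 := by positivity
  have h6 : 0 ≤ δ / 2 * ‖lamhat‖ ^ 2 := by positivity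
  linarith

end IsSaddle

end MILP

namespace MILP

variable {P : MILP} {N : ℕ}

lemma inner_eq_sum_dualBlock (owner : Fin P.y → Fin N) (x y : P.Dual) :
    inner ℝ x y = ∑ a, inner ℝ (P.dualBlock owner a x) (P.dualBlock owner a y) := by
  simp only [PiLp.inner_apply, dualBlock]
  exact (Fintype.sum_fiberwise owner fun ζ => inner ℝ (x ζ) (y ζ)).symm

lemma dualBlock_add (owner : Fin P.y → Fin N) (a : Fin N) (x y : P.Dual) :
    P.dualBlock owner a (x + y) = P.dualBlock owner a x + P.dualBlock owner a y := rfl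

lemma dualBlock_sub (owner : Fin P.y → Fin N) (a : Fin N) (x y : P.Dual) :
    P.dualBlock owner a (x - y) = P.dualBlock owner a x - P.dualBlock owner a y := rfl

lemma dualBlock_smul (owner : Fin P.y → Fin N) (a : Fin N) (c : ℝ) (x : P.Dual) :
    P.dualBlock owner a (c • x) = c • P.dualBlock owner a x := rfl

lemma dualBlock_mem_Mblock {owner : Fin P.y → Fin N} {α : ℝ} {zbar : P.Primal} {lam : P.Dual}
    (h0 : lam ∈ P.nonnegDual) (h1 : ∑ ζ, |lam ζ| ≤ P.dualBound α zbar) (a : Fin N) :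
    P.dualBlock owner a lam ∈ P.Mblock owner α zbar a := by
  refine ⟨fun ζ => h0 ζ.1, le_trans ?_ h1⟩
  rw [← Fintype.sum_fiberwise owner fun ζ => |lam ζ|]
  exact Finset.single_le_sum (f := fun a => ∑ ζ : {ζ // owner ζ = a}, |lam ζ|)
    (fun a _ => Finset.sum_nonneg fun ζ _ => abs_nonneg _) (Finset.mem_univ a)

lemma convex_Mblock (owner : Fin P.y → Fin N) (α : ℝ) (zbar : P.Primal) (a : Fin N) :
    Convex ℝ (P.Mblock owner α zbar a) := by
  intro x hx y hy c d hc hd hcd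
  refine ⟨fun ζ => add_nonneg (mul_nonneg hc (hx.1 ζ)) (mul_nonneg hd (hy.1 ζ)), ?_⟩
  have h1 : ∑ ζ, |(c • x + d • y) ζ| ≤ ∑ ζ, (c * |x ζ| + d * |y ζ|) := by
    refine Finset.sum_le_sum fun ζ _ => (abs_add_le _ _).trans_eq ?_
    simp [abs_mul, abs_of_nonneg hc, abs_of_nonneg hd]
  rw [Finset.sum_add_distrib, ← Finset.mul_sum, ← Finset.mul_sum] at h1
  calc _ ≤ _ := h1
    _ ≤ c * P.dualBound α zbar + d * P.dualBound α zbar :=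
        add_le_add (mul_le_mul_of_nonneg_left hx.2 hc) (mul_le_mul_of_nonneg_left hy.2 hd)
    _ = P.dualBound α zbar := by rw [← add_mul, hcd, one_mul]

namespace Memory

variable {μ : P.Memory N} {owner : Fin P.y → Fin N}

lemma lam_congr {k l : ℕ}
    (h : ∀ a, P.dualBlock owner a (μ.lamD a k) = P.dualBlock owner a (μ.lamD a l)) :
    μ.lam owner k = μ.lam owner l := by
  ext ζ
  exact congrArg (fun v => v ⟨ζ, rfl⟩) (h (owner ζ))

lemma dualBlock_lam (μ : P.Memory N) (owner : Fin P.y → Fin N) (a : Fin N) (k : ℕ) :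
    P.dualBlock owner a (μ.lam owner k) = P.dualBlock owner a (μ.lamD a k) := by
  ext ⟨ζ, rfl⟩
  rfl

namespace IsRun

variable {α δ β γ : ℝ} {B : ℕ} {zbar : P.Primal} {σ : P.Schedule}

lemma block_mem (h : μ.IsRun owner α δ β γ B zbar σ) (i : Fin P.m) (k : ℕ) :
    μ.zP i k i ∈ P.Zblock i := by
  induction k with
  | zero => exact h.init_primal i i
  | succ k ih =>
    by_cases hk : k ∈ σ.K i
    · exact (h.primal_update i k hk).1
    · rwa [h.primal_hold i k hk]

lemma z_mem (h : μ.IsRun owner α δ β γ B zbar σ) (k : ℕ) : μ.z k ∈ P.Z :=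
  fun i => h.block_mem i k

lemma lam_eq_of_forall_notMem (h : μ.IsRun owner α δ β γ B zbar σ) {s t : ℕ}
    (hst : ∀ u ∈ σ.D, s < u → t ≤ u) {k : ℕ} (hsk : s * B ≤ k) (hkt : k < t * B) :
    μ.lam owner k = μ.lam owner (s * B) := by
  induction k, hsk using Nat.le_induction with
  | base => rfl
  | succ k hk ih =>
    rw [← ih (by omega)]
    refine lam_congr fun a => h.dual_hold a k fun u hu hku => ?_
    have h1 : s < u := lt_of_mul_lt_mul_right (a := B) (by omega) (Nat.zero_le B)
    have h2 := Nat.mul_le_mul_right B (hst u hu h1)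
    omega

/-- The gradient used by a primal agent is that of the Lagrangian at the true dual iterate. -/
lemma primalGrad_apply_eq (h : μ.IsRun owner α δ β γ B zbar σ) (i : Fin P.m) (k : ℕ) :
    P.primalGrad α (μ.zP i k) (μ.lamP i k) i =
      P.primalGrad α (μ.z k) (μ.lam owner k) i := by
  have h1 : ContinuousLinearMap.adjoint P.Aop (μ.lamP i k) i =
      ContinuousLinearMap.adjoint P.Aop (μ.lam owner k) i := by
    refine adjoint_apply_congr fun ζ hζ => ?_
    have h2 := h.dual_to_primal i (owner ζ) ⟨ζ, rfl, hζ⟩ k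
    exact congrArg (fun v => v ⟨ζ, rfl⟩) h2
  simp only [primalGrad, PiLp.add_apply, PiLp.smul_apply, h1]
  rfl

/-- One projected gradient step contracts the distance of the block to the block of the minimizer
of the current Lagrangian. -/
lemma norm_block_sub_le (h : μ.IsRun owner α δ β γ B zbar σ) (hα : 0 < α) (hγ : 0 < γ)
    (hγα : α * γ ≤ 1) {i : Fin P.m} {k : ℕ} (hk : k ∈ σ.K i) {w : P.Primal} (hw : w ∈ P.Z)
    (hmin : IsMinOn (fun z => P.L α δ z (μ.lam owner k)) P.Z w) :
    ‖μ.z (k + 1) i - w i‖ ≤ (1 - α * γ) * ‖μ.z k i - w i‖ := by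
  have h1 := h.primal_update i k hk
  rw [gradient_L_primal, h.primalGrad_apply_eq] at h1
  have h2 := h1.inner_nonpos (convex_convexHull ℝ (P.X i)) (hw i)
  have h3 := primalGrad_block_inner_nonneg hα hw hmin h1.1
  have h4 : inner ℝ ((w i - γ • P.primalGrad α w (μ.lam owner k) i) - w i)
      (μ.zP i (k + 1) i - w i) ≤ 0 := by
    rw [sub_sub_cancel_left, inner_neg_left, real_inner_smul_left]
    nlinarith
  refine (norm_sub_le_of_inner_nonpos h2 h4).trans_eq ?_
  have h5 : μ.zP i k i - γ • P.primalGrad α (μ.z k) (μ.lam owner k) i -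
      (w i - γ • P.primalGrad α w (μ.lam owner k) i) = (1 - α * γ) • (μ.z k i - w i) := by
    have h6 : μ.zP i k i = μ.z k i := rfl
    rw [h6]
    simp only [primalGrad, PiLp.add_apply, PiLp.smul_apply]
    module
  rw [h5, norm_smul, Real.norm_of_nonneg (by linarith)]

/-- Between dual updates every `B` consecutive time steps contract the distance to the minimizer
of the Lagrangian. -/
lemma norm_sub_le_pow (h : μ.IsRun owner α δ β γ B zbar σ) (hσ : σ.BoundedDelays B) (hB : 0 < B)
    (hα : 0 < α) (hγ : 0 < γ) (hγα : α * γ ≤ 1) {s t : ℕ} (hst : s ≤ t)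
    (hD : ∀ u ∈ σ.D, s < u → t ≤ u) {w : P.Primal} (hw : w ∈ P.Z)
    (hmin : IsMinOn (fun z => P.L α δ z (μ.lam owner (s * B))) P.Z w) :
    ‖μ.z (t * B) - w‖ ≤ (1 - α * γ) ^ (t - s) * ‖μ.z (s * B) - w‖ := by
  have hq0 : 0 ≤ 1 - α * γ := by linarith
  have hq1 : 1 - α * γ ≤ 1 := by nlinarith [mul_pos hα hγ]
  have hmin' : ∀ k, s * B ≤ k → k < t * B →
      IsMinOn (fun z => P.L α δ z (μ.lam owner k)) P.Z w := by
    intro k hk hk'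
    rwa [h.lam_eq_of_forall_notMem hD hk hk']
  have hstep : ∀ i k, s * B ≤ k → k < t * B →
      ‖μ.z (k + 1) i - w i‖ ≤ ‖μ.z k i - w i‖ := by
    intro i k hk hk'
    by_cases hki : k ∈ σ.K i
    · exact (h.norm_block_sub_le hα hγ hγα hki hw (hmin' k hk hk')).trans
        (mul_le_of_le_one_left (norm_nonneg _) hq1)
    · exact (congrArg (fun x => ‖x - w i‖) (h.primal_hold i k hki)).le
  have hmono : ∀ i k l, s * B ≤ k → k ≤ l → l ≤ t * B →
      ‖μ.z l i - w i‖ ≤ ‖μ.z k i - w i‖ := by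
    intro i k l hk hkl
    induction l, hkl using Nat.le_induction with
    | base => exact fun _ => le_rfl
    | succ l hl ih => exact fun h' => (hstep i l (by omega) (by omega)).trans (ih (by omega))
  have hpow : ∀ i j, s + j ≤ t →
      ‖μ.z ((s + j) * B) i - w i‖ ≤ (1 - α * γ) ^ j * ‖μ.z (s * B) i - w i‖ := by
    intro i j
    induction j with
    | zero => simp
    | succ j ih =>
      intro hj
      obtain ⟨k, hki, hk1, hk2⟩ := hσ.update i ((s + j) * B)
      have e1 : (s + (j + 1)) * B = (s + j) * B + B := by ring
      have e2 : (s + (j + 1)) * B ≤ t * B := Nat.mul_le_mul_right B hj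
      have e3 : s * B ≤ (s + j) * B := Nat.mul_le_mul_right B (by omega)
      calc ‖μ.z ((s + (j + 1)) * B) i - w i‖ ≤ ‖μ.z (k + 1) i - w i‖ :=
            hmono i _ _ (by omega) (by omega) e2
        _ ≤ (1 - α * γ) * ‖μ.z k i - w i‖ :=
            h.norm_block_sub_le hα hγ hγα hki hw (hmin' k (by omega) (by omega))
        _ ≤ (1 - α * γ) * ((1 - α * γ) ^ j * ‖μ.z (s * B) i - w i‖) :=
            mul_le_mul_of_nonneg_left
              ((hmono i _ _ e3 hk1 (by omega)).trans (ih (by omega))) hq0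
        _ = (1 - α * γ) ^ (j + 1) * ‖μ.z (s * B) i - w i‖ := by ring
  refine le_of_sq_le_sq ?_ (by positivity)
  rw [mul_pow, PiLp.norm_sq_eq_of_L2, PiLp.norm_sq_eq_of_L2, Finset.mul_sum]
  refine Finset.sum_le_sum fun i _ => ?_
  have h1 := hpow i (t - s) (by omega)
  rw [Nat.add_sub_cancel' hst] at h1
  rw [← mul_pow]
  exact pow_le_pow_left₀ (norm_nonneg _) h1 2

/-- A dual update is nonexpansive relative to the optimal multiplier. -/
lemma norm_lam_sub_le (h : μ.IsRun owner α δ β γ B zbar σ) (hZ : IsCompact P.Z) (hα : 0 < α)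
    (hδ : 0 < δ) (hβ : 0 < β) (hB : 0 < B) (hs : P.IsSlater zbar)
    {zhat : P.Primal} {lamhat : P.Dual} (hsad : P.IsSaddle α δ zhat lamhat) {s t : ℕ}
    (ht : t ∈ σ.D) (hst : s < t) (hD : ∀ u ∈ σ.D, s < u → t ≤ u) :
    ‖μ.lam owner (t * B) - lamhat‖ ≤
      ‖(1 - β * δ) • (μ.lam owner (s * B) - lamhat) + β • P.Aop (μ.z (t * B) - zhat)‖ := by
  have hB' : (s + 1) * B ≤ t * B := Nat.mul_le_mul_right B hst
  have e1 : (s + 1) * B = s * B + B := by ring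
  have hlam : μ.lam owner (t * B - 1) = μ.lam owner (s * B) :=
    h.lam_eq_of_forall_notMem hD (by omega) (by omega)
  set lam := μ.lam owner (s * B) with hlamdef
  have hgrad : ∀ a, P.dualBlock owner a (P.dualGrad δ (μ.zD a (t * B)) (μ.lamD a (t * B - 1))) =
      P.dualBlock owner a (P.dualGrad δ (μ.z (t * B)) lam) := by
    intro a
    rw [dualGrad, dualGrad, dualBlock_sub, dualBlock_sub, dualBlock_smul, dualBlock_smul,
      ← dualBlock_lam, hlam]
    congr 1
    ext ⟨ζ, rfl⟩
    exact g_apply_congr fun i hi => h.primal_to_dual t ht (owner ζ) i ⟨ζ, rfl, hi⟩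
  have hupd : ∀ a, IsProjOnto (P.Mblock owner α zbar a)
      (P.dualBlock owner a (lam + β • P.dualGrad δ (μ.z (t * B)) lam))
      (P.dualBlock owner a (μ.lam owner (t * B))) := by
    intro a
    have h1 := h.dual_update t ht a
    rwa [gradient_L_dual, hgrad, ← dualBlock_lam, ← dualBlock_lam, hlam, ← dualBlock_smul,
      ← dualBlock_add] at h1
  have hvi : inner ℝ (lam + β • P.dualGrad δ (μ.z (t * B)) lam - μ.lam owner (t * B))
      (lamhat - μ.lam owner (t * B)) ≤ 0 := by
    rw [inner_eq_sum_dualBlock owner]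
    exact Finset.sum_nonpos fun a _ => (hupd a).inner_nonpos (convex_Mblock owner α zbar a)
      (dualBlock_mem_Mblock hsad.2.1 (hsad.sum_abs_le_dualBound hZ hα hδ hs) a)
  have hnonneg : μ.lam owner (t * B) ∈ P.nonnegDual := fun ζ => (hupd (owner ζ)).1.1 ⟨ζ, rfl⟩
  have hvi' : inner ℝ (lamhat + β • P.dualGrad δ zhat lamhat - lamhat)
      (μ.lam owner (t * B) - lamhat) ≤ 0 := by
    rw [add_sub_cancel_left, real_inner_smul_left]
    exact mul_nonpos_of_nonneg_of_nonpos hβ.le (hsad.dualGrad_inner_nonpos hδ hnonneg)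
  refine (norm_sub_le_of_inner_nonpos hvi hvi').trans_eq (congrArg norm ?_)
  rw [← g_sub]
  simp only [dualGrad]
  module

end IsRun

end Memory

/-- The estimate behind one dual step, for step sizes that make the exact dual step a
contraction. -/
lemma sq_norm_dual_step_le_of_small {F : Type*} [NormedAddCommGroup F] [InnerProductSpace ℝ F]
    {e d w : F} {β κ s D : ℝ}
    (hβ : 0 < β) (hdw : ‖d‖ * ‖w‖ ≤ D)
    (hmono : β * ‖d‖ ^ 2 + 2 * κ * inner ℝ e d ≤ 0) (hw : ‖w‖ ^ 2 ≤ s) :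
    ‖κ • e + β • (d + w)‖ ^ 2 ≤
      (κ ^ 2 + β ^ 2) * ‖e‖ ^ 2 + ((κ ^ 2 + β ^ 2) * s + 2 * β ^ 2 * D) := by
  have h1 : ‖κ • e + β • (d + w)‖ ^ 2 = κ ^ 2 * ‖e‖ ^ 2 + β ^ 2 * ‖d‖ ^ 2 + β ^ 2 * ‖w‖ ^ 2 +
      2 * κ * β * inner ℝ e d + 2 * κ * β * inner ℝ e w + 2 * β ^ 2 * inner ℝ d w := by
    rw [norm_add_sq_real, norm_smul, norm_smul, mul_pow, mul_pow, norm_add_sq_real,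
      real_inner_smul_left, real_inner_smul_right, inner_add_right, Real.norm_eq_abs,
      Real.norm_eq_abs, sq_abs, sq_abs]
    ring
  have h2 : 2 * κ * β * inner ℝ e w ≤ β ^ 2 * ‖e‖ ^ 2 + κ ^ 2 * ‖w‖ ^ 2 := by
    have h3 : 0 ≤ ‖β • e - κ • w‖ ^ 2 := sq_nonneg _
    rw [norm_sub_sq_real, norm_smul, norm_smul, mul_pow, mul_pow, real_inner_smul_left,
      real_inner_smul_right, Real.norm_eq_abs, Real.norm_eq_abs, sq_abs, sq_abs] at h3
    linarith
  have h4 : β ^ 2 * inner ℝ d w ≤ β ^ 2 * D :=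
    mul_le_mul_of_nonneg_left ((real_inner_le_norm d w).trans hdw) (sq_nonneg β)
  have h5 := mul_le_mul_of_nonneg_left hw (by positivity : 0 ≤ κ ^ 2 + β ^ 2)
  nlinarith [mul_nonpos_of_nonneg_of_nonpos hβ.le hmono]

/-- The estimate behind one dual step without a restriction of the step size. -/
lemma sq_norm_dual_step_le {F : Type*} [NormedAddCommGroup F] [InnerProductSpace ℝ F]
    {e v : F} {β κ s : ℝ} (hv : ‖v‖ ^ 2 ≤ s) :
    ‖κ • e + β • v‖ ^ 2 ≤ (κ ^ 2 + β ^ 2) * ‖e‖ ^ 2 + (κ ^ 2 + β ^ 2) * s := by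
  have h1 : ‖κ • e + β • v‖ ^ 2 =
      κ ^ 2 * ‖e‖ ^ 2 + β ^ 2 * ‖v‖ ^ 2 + 2 * κ * β * inner ℝ e v := by
    rw [norm_add_sq_real, norm_smul, norm_smul, mul_pow, mul_pow, real_inner_smul_left,
      real_inner_smul_right, Real.norm_eq_abs, Real.norm_eq_abs, sq_abs, sq_abs]
    ring
  have h3 : 0 ≤ ‖β • e - κ • v‖ ^ 2 := sq_nonneg _
  rw [norm_sub_sq_real, norm_smul, norm_smul, mul_pow, mul_pow, real_inner_smul_left,
    real_inner_smul_right, Real.norm_eq_abs, Real.norm_eq_abs, sq_abs, sq_abs] at h3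
  have h5 := mul_le_mul_of_nonneg_left hv (by positivity : 0 ≤ κ ^ 2 + β ^ 2)
  nlinarith

/-- The squared distance to the optimal multiplier after one dual update. -/
lemma Memory.IsRun.sq_norm_lam_sub_le {μ : P.Memory N} {owner : Fin P.y → Fin N}
    {α δ β γ : ℝ} {B : ℕ} {zbar : P.Primal} {σ : P.Schedule}
    (h : μ.IsRun owner α δ β γ B zbar σ) (hσ : σ.BoundedDelays B)
    (hZne : P.Z.Nonempty) (hZ : IsCompact P.Z) (hα : 0 < α)
    (hδ : 0 < δ) (hβ : 0 < β) (hB : 0 < B) (hγ : 0 < γ) (hγα : α * γ ≤ 1)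
    (hβδ : β * δ ≤ 1) (hqd : (1 - β * δ) ^ 2 + β ^ 2 ≤ 1)
    (hcase : β * (‖P.Aop‖ ^ 2 + 2 * α * δ) ≤ 2 * α ∨ α * γ ≤ β ^ 2 * (1 - α * γ))
    (hs : P.IsSlater zbar)
    {zhat : P.Primal} {lamhat : P.Dual} (hsad : P.IsSaddle α δ zhat lamhat) {s t : ℕ}
    (ht : t ∈ σ.D) (hst : s < t) (hD : ∀ u ∈ σ.D, s < u → t ≤ u) :
    ‖μ.lam owner (t * B) - lamhat‖ ^ 2 ≤
      ((1 - β * δ) ^ 2 + β ^ 2) * ‖μ.lam owner (s * B) - lamhat‖ ^ 2 +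
      (4 * P.r ^ 2 * ((1 - β * δ) ^ 2 + β ^ 2) * (1 - α * γ) ^ 2 * ‖P.Aop‖ ^ 2 +
        8 * P.r ^ 2 * β ^ 2 * (1 - α * γ) * ‖P.Aop‖ ^ 2) := by
  have hr := P.r_nonneg
  have hA := norm_nonneg P.Aop
  have hq0 : 0 ≤ 1 - α * γ := by linarith
  have hq1 : 1 - α * γ ≤ 1 := by nlinarith [mul_pos hα hγ]
  refine (pow_le_pow_left₀ (norm_nonneg _)
    (h.norm_lam_sub_le hZ hα hδ hβ hB hs hsad ht hst hD) 2).trans ?_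
  rcases hcase with hsmall | hlarge
  · obtain ⟨w, hw, hwmin⟩ := exists_argmin hZne hZ α δ (μ.lam owner (s * B))
    have hsplit : P.Aop (μ.z (t * B) - zhat) = P.Aop (w - zhat) + P.Aop (μ.z (t * B) - w) := by
      rw [← map_add, add_comm, sub_add_sub_cancel]
    have hzw : ‖μ.z (t * B) - w‖ ≤ (1 - α * γ) * (2 * P.r) :=
      (h.norm_sub_le_pow hσ hB hα hγ hγα hst.le hD hw hwmin).trans
        (mul_le_mul (pow_le_of_le_one hq0 hq1 (by omega))
          (norm_sub_le_two_mul_r hZ (h.z_mem _) hw) (norm_nonneg _) hq0)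
    have hAzw : ‖P.Aop (μ.z (t * B) - w)‖ ≤ ‖P.Aop‖ * ((1 - α * γ) * (2 * P.r)) :=
      (P.Aop.le_opNorm _).trans (mul_le_mul_of_nonneg_left hzw hA)
    have hAwz : ‖P.Aop (w - zhat)‖ ≤ ‖P.Aop‖ * (2 * P.r) :=
      (P.Aop.le_opNorm _).trans
        (mul_le_mul_of_nonneg_left (norm_sub_le_two_mul_r hZ hw hsad.1) hA)
    have hmono : β * ‖P.Aop (w - zhat)‖ ^ 2 +
        2 * (1 - β * δ) * inner ℝ (μ.lam owner (s * B) - lamhat) (P.Aop (w - zhat)) ≤ 0 := by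
      have h1 := mul_le_mul_of_nonneg_left (inner_Aop_sub_le hα hw hwmin hsad.1 hsad.isMinOn)
        (by linarith : 0 ≤ 2 * (1 - β * δ))
      have h2 := mul_le_mul_of_nonneg_left
        (pow_le_pow_left₀ (norm_nonneg _) (P.Aop.le_opNorm (w - zhat)) 2) hβ.le
      nlinarith [mul_le_mul_of_nonneg_right hsmall (sq_nonneg ‖w - zhat‖)]
    have hsq := pow_le_pow_left₀ (norm_nonneg _) hAzw 2
    have hprod := mul_le_mul hAwz hAzw (norm_nonneg _) (by positivity)
    rw [hsplit]
    refine (sq_norm_dual_step_le_of_small hβ hprod hmono hsq).trans_eq ?_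
    ring
  · have hAz : ‖P.Aop (μ.z (t * B) - zhat)‖ ≤ ‖P.Aop‖ * (2 * P.r) :=
      (P.Aop.le_opNorm _).trans
        (mul_le_mul_of_nonneg_left (norm_sub_le_two_mul_r hZ (h.z_mem _) hsad.1) hA)
    refine (sq_norm_dual_step_le (pow_le_pow_left₀ (norm_nonneg _) hAz 2)).trans ?_
    have hqd0 : 0 ≤ (1 - β * δ) ^ 2 + β ^ 2 := by positivity
    set q := 1 - α * γ with hqdef
    set Q := (1 - β * δ) ^ 2 + β ^ 2
    have hfac : Q ≤ Q * q ^ 2 + 2 * β ^ 2 * q := by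
      have h1 : Q * (1 - q ^ 2) ≤ 1 * (1 - q ^ 2) :=
        mul_le_mul_of_nonneg_right hqd (by nlinarith)
      nlinarith
    nlinarith [mul_le_mul_of_nonneg_left hfac (by positivity : 0 ≤ 4 * P.r ^ 2 * ‖P.Aop‖ ^ 2)]

end MILP

end

theorem theorem3 (P : MILP) (hZne : P.Z.Nonempty) (hZcpt : IsCompact P.Z)
    (α δ : ℝ) (hα : 0 < α) (hδ : 0 < δ) (B : ℕ) (hB : 0 < B) :
    ∃ γ₁ θ : ℝ, 0 < γ₁ ∧ 0 < θ ∧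
      ∀ γ : ℝ, 0 < γ → γ < γ₁ →
      ∀ β : ℝ, 0 < β →
        β < min (2 * α / (‖P.Aop‖ + 2 * α * δ)) (2 * δ / (1 + δ ^ 2)) →
      ∀ q_p q_d : ℝ, q_p = 1 - θ * γ → q_d = (1 - β * δ) ^ 2 + β ^ 2 →
        (0 ≤ q_p ∧ q_p < 1) ∧ (0 ≤ q_d ∧ q_d < 1) ∧
        ∀ zbar : P.Primal, P.IsSlater zbar →
        ∀ (N : ℕ) (owner : Fin P.y → Fin N) (σ : P.Schedule) (μ : P.Memory N),
          σ.IsValid → σ.BoundedDelays B → μ.IsRun owner α δ β γ B zbar σ →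
        ∀ (zhat : P.Primal) (lamhat : P.Dual), P.IsSaddle α δ zhat lamhat →
        ∀ (n : ℕ) (t : ℕ → ℕ), 1 ≤ n → t 0 = 0 →
          (∀ i < n, IsLeast {s | s ∈ σ.D ∧ t i < s} (t (i + 1))) →
          (∀ w ∈ P.Z, IsMinOn (fun z => P.L α δ z (μ.lam owner (t (n - 1) * B))) P.Z w →
            ‖μ.z (t n * B) - w‖ ≤ q_p ^ (t n - t (n - 1)) * ‖μ.z (t (n - 1) * B) - w‖) ∧
          ‖μ.z (t n * B) - zhat‖ ≤
            2 * q_p ^ (t n - t (n - 1)) * P.r +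
              ‖P.Aop‖ / α *
                √(q_d ^ (n - 1) * ‖μ.lam owner 0 - lamhat‖ ^ 2 +
                  (4 * P.r ^ 2 * q_d * q_p ^ 2 * ‖P.Aop‖ ^ 2 +
                    8 * P.r ^ 2 * β ^ 2 * q_p * ‖P.Aop‖ ^ 2) *
                  ∑ i ∈ Finset.range n, q_d ^ i) := by
  have hA := norm_nonneg P.Aop
  -- Dual steps of size at most `β₀` contract; for larger ones `q_p` has to be close to `1`.
  set β₀ : ℝ := 2 * α / (‖P.Aop‖ ^ 2 + 2 * α * δ) with hβ₀def
  have hden : 0 < ‖P.Aop‖ ^ 2 + 2 * α * δ := by positivity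
  have hβ₀ : 0 < β₀ := by positivity
  refine ⟨β₀ ^ 2 / (1 + β₀ ^ 2) / α, α, by positivity, hα, ?_⟩
  intro γ hγ hγ₁ β hβ hβlt q_p q_d hqp hqd
  have hγε : α * γ < β₀ ^ 2 / (1 + β₀ ^ 2) := by
    rwa [lt_div_iff₀ hα, mul_comm] at hγ₁
  have hε1 : β₀ ^ 2 / (1 + β₀ ^ 2) < 1 := (div_lt_one (by positivity)).2 (by linarith)
  have hγα : α * γ ≤ 1 := (hγε.trans hε1).le
  have hγβ₀ : α * γ ≤ β₀ ^ 2 * (1 - α * γ) := by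
    rw [lt_div_iff₀ (by positivity)] at hγε
    linarith
  obtain ⟨hβ1, hβ2⟩ := lt_min_iff.1 hβlt
  rw [lt_div_iff₀ (by positivity)] at hβ1 hβ2
  have hβδ : β * δ ≤ 1 := by nlinarith [mul_nonneg hβ.le hA]
  have hqp0 : 0 ≤ q_p := by linarith
  have hqp1 : q_p < 1 := by nlinarith [mul_pos hα hγ]
  have hqd0 : 0 ≤ q_d := by rw [hqd]; positivity
  have hqd1 : q_d < 1 := by nlinarith
  refine ⟨⟨hqp0, hqp1⟩, ⟨hqd0, hqd1⟩, ?_⟩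
  intro zbar hs N owner σ μ _ hσ h zhat lamhat hsad n t hn ht0 ht
  have hcase : β * (‖P.Aop‖ ^ 2 + 2 * α * δ) ≤ 2 * α ∨ α * γ ≤ β ^ 2 * (1 - α * γ) := by
    rcases le_total β β₀ with hle | hle
    · exact Or.inl ((le_div_iff₀ hden).1 hle)
    · exact Or.inr (hγβ₀.trans
        (mul_le_mul_of_nonneg_right (pow_le_pow_left₀ hβ₀.le hle 2) (by linarith)))
  set C : ℝ := 4 * P.r ^ 2 * q_d * q_p ^ 2 * ‖P.Aop‖ ^ 2 +
    8 * P.r ^ 2 * β ^ 2 * q_p * ‖P.Aop‖ ^ 2 with hC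
  have hC0 : 0 ≤ C := by positivity
  have hdual : ∀ j ≤ n, ‖μ.lam owner (t j * B) - lamhat‖ ^ 2 ≤
      q_d ^ j * ‖μ.lam owner 0 - lamhat‖ ^ 2 + C * ∑ i ∈ Finset.range j, q_d ^ i := by
    intro j
    induction j with
    | zero => simp [ht0]
    | succ j ih =>
      intro hj
      obtain ⟨⟨h1, h2⟩, h3⟩ := ht j hj
      have h4 := h.sq_norm_lam_sub_le hσ hZne hZcpt hα hδ hβ hB hγ hγα hβδ (hqd ▸ hqd1.le) hcase
        hs hsad h1 h2 (fun u hu hlt => h3 ⟨hu, hlt⟩)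
      rw [← hqd, ← hqp, ← hC] at h4
      have h5 := mul_le_mul_of_nonneg_left (ih (by omega)) hqd0
      rw [Finset.sum_range_succ', pow_zero]
      simp only [pow_succ, ← Finset.sum_mul]
      linarith
  obtain ⟨j, rfl⟩ : ∃ j, n = j + 1 := ⟨n - 1, by omega⟩
  simp only [Nat.add_sub_cancel]
  obtain ⟨⟨h1, h2⟩, h3⟩ := ht j (by omega)
  have hprimal : ∀ w ∈ P.Z, IsMinOn (fun z => P.L α δ z (μ.lam owner (t j * B))) P.Z w →
      ‖μ.z (t (j + 1) * B) - w‖ ≤ q_p ^ (t (j + 1) - t j) * ‖μ.z (t j * B) - w‖ := by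
    intro w hw hwmin
    rw [hqp]
    exact h.norm_sub_le_pow hσ hB hα hγ hγα h2.le (fun u hu hlt => h3 ⟨hu, hlt⟩) hw hwmin
  refine ⟨hprimal, ?_⟩
  obtain ⟨w, hw, hwmin⟩ := MILP.exists_argmin hZne hZcpt α δ (μ.lam owner (t j * B))
  have h4 := (hprimal w hw hwmin).trans (mul_le_mul_of_nonneg_left
    (MILP.norm_sub_le_two_mul_r hZcpt (h.z_mem _) hw) (pow_nonneg hqp0 _))
  have h5 := MILP.norm_argmin_sub_le hα hw hwmin hsad.1 hsad.isMinOn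
  have h6 : ‖μ.lam owner (t j * B) - lamhat‖ ≤
      √(q_d ^ j * ‖μ.lam owner 0 - lamhat‖ ^ 2 + C * ∑ i ∈ Finset.range (j + 1), q_d ^ i) := by
    refine Real.le_sqrt_of_sq_le ((hdual j (by omega)).trans ?_)
    rw [Finset.sum_range_succ]
    nlinarith [mul_nonneg hC0 (pow_nonneg hqd0 j)]
  have h7 := mul_le_mul_of_nonneg_left h6 (by positivity : 0 ≤ ‖P.Aop‖ / α)
  have h8 := norm_sub_le_norm_sub_add_norm_sub (μ.z (t (j + 1) * B)) w zhat
  linarith
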